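/- For $a,b,c>0$ with $a+b\ge c$ let $$\mu_{a,b,c}(r)=\frac{B(a,b)}{2}\,\frac{F(a,b;c;1-r^2)}{F(a,b;c;r^2)},\qquad r\in(0,1),$$ where $B$ is the beta function and $F={}_2F_1$ is the Gaussian hypergeometric function; this is a decreasing homeomorphism of $(0,1)$ onto $(0,\infty)$. For $0<a<c$ and $K>0$ put $\mu_{a,c}=\mu_{a,c-a,c}$ and $$\varphi_K(r)=\varphi_K^{a,c}(r)=\mu_{a,c}^{-1}\bigl(\mu_{a,c}(r)/K\bigr),\qquad r\in(0,1),$$ and write $r'=\sqrt{1-r^2}$. **Theorem.** Let $0<a<c\le 1$ and $K\in(1,\infty)$. (1) The function $f_1(r)=\log\varphi_K(r')$ is strictly decreasing and concave on $(0,1)$. Moreover, for all $u,t\in(0,1)$, $$\varphi_K(u')\varphi_K(t')\le\varphi_K\left(\sqrt{1-\left(\tfrac{u+t}{2}\right)^2}\right)^2,\qquad \varphi_K(u)\varphi_K(t)\le\varphi_K\left(\sqrt{1-\sqrt{(1-u^2)(1-t^2)}}\right)^2,$$ with equality, in each of the two inequalities, if and only if $u=t$. (2) The function $f_2(r)=\log\varphi_K(r'^2)$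 is strictly decreasing and concave on $(0,1)$. Moreover, for all $u,t\in(0,1)$, $$\varphi_K(u'^2)\varphi_K(t'^2)\le\varphi_K\left(1-\left(\tfrac{u+t}{2}\right)^2\right)^2,\qquad \varphi_K(u^2)\varphi_K(t^2)\le\varphi_K\left(1-\sqrt{(1-u^2)(1-t^2)}\right)^2,$$ with equality, in each of the two inequalities, if and only if $u=t$. (3) The function $f_3(r)=\log\varphi_K(1-e^{-r})$ is strictly increasing and concave on $(0,\infty)$. Moreover, for all $u,t\in(0,1)$, $$\varphi_K(1-u)\varphi_K(1-t)\le\varphi_K\left(1-\sqrt{ut}\right)^2,\qquad \varphi_K(u)\varphi_K(t)\le\varphi_K\left(1-\sqrt{(1-u)(1-t)}\right)^2,$$ with equality, in each of the two inequalities, if and only if $u=t$. -/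

import Mathlib

namespace GenModular

noncomputable section

/-- The complementary argument `r' = √(1 - r²)`. -/
def compl (r : ℝ) : ℝ := Real.sqrt (1 - r ^ 2)

/-- The generalized modulus
`μ_{a,b,c}(r) = (B(a,b) / 2) * F(a,b;c;r'²) / F(a,b;c;r²)`, for `r ∈ (0,1)`;
`B` is the beta function and `F` the Gaussian hypergeometric function `₂F₁`. -/
def modulus (a b c r : ℝ) : ℝ :=
  ProbabilityTheory.beta a b / 2 *
    (ordinaryHypergeometric a b c (compl r ^ 2) / ordinaryHypergeometric a b c (r ^ 2))

/-- The inverse of the generalized modulus `μ_{a,b,c} : (0,1) → (0,∞)`. -/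
def modulusInv (a b c : ℝ) : ℝ → ℝ :=
  Function.invFunOn (modulus a b c) (Set.Ioo 0 1)

/-- The `(a,b,c)`-modular function with degree `1 / K`:
`φ_K^{a,b,c}(r) = μ_{a,b,c}⁻¹ (μ_{a,b,c}(r) / K)`. -/
def modularFun (a b c K r : ℝ) : ℝ := modulusInv a b c (modulus a b c r / K)

/-- The two-parameter modular function `φ_K^{a,c} = φ_K^{a,c-a,c}`. -/
def phi (a c K r : ℝ) : ℝ := modularFun a (c - a) c K r

end

end GenModular

open Set Filter Topology

namespace GenModular

/-! Work in x = r². Write F for `hyp a c`, E = (1 - x)F' for `hypE a c`, and y = `sqPhi a c K x`, so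
that φ_K(r)² = y at x = r². All three concavity claims reduce to one fact
(`strictAntiOn_sqrt_mul_slope`): if s is the logarithmic derivative of y in x, then G(x) = √x √(1 -
√x) s(x) is strictly decreasing. At x = v², with v the argument of φ_K, the derivatives of f₂, f₁
and f₃ are -2G, -G √(1 + v)/v and G √(1 - v) respectively.

The relation F(1 - y)/F(y) = F(1 - x)/(K F(x)) eliminates F(1 - x) and F(1 - y) from s. With the
Legendre-type function L = `leg a c` this splits G into a product of four positive factors and 1/K:
L(x)/√x, √(1 - y)/L(y), √(1 - y)F(y)² / (√(1 - x)F(x)²), and 1/√(1 + √x). The last is strictly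
decreasing. The first two are decreasing because 2xL' ≤ L and L is symmetric under x ↦ 1 - x. The
third is decreasing because E/F decreases and xF'/F increases, both instances of Chebyshev's
inequality for power series. The assumption c ≤ 1 enters through a(c - a)/c ≤ 1/4, through
coefficients of F at most 1, and through 1 - c ≥ 0 in L'.

Strict concavity at midpoints gives the product inequalities with their equality cases; the
arithmetic-geometric mean inequality converts midpoints to products where needed. -/

/-- The sum of the real power series with coefficients `A`. -/
noncomputable def powSum (A : ℕ → ℝ) (x : ℝ) : ℝ := ∑' n, A n * x ^ n

/-! ### Power series with bounded coefficients, and Chebyshev's inequality -/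

section PowSum

variable {A : ℕ → ℝ} {C : ℝ}

lemma summable_powSum (hA : ∀ n, |A n| ≤ C) {x : ℝ} (hx : |x| < 1) :
    Summable fun n => A n * x ^ n := by
  refine Summable.of_norm_bounded (g := fun n => C * |x| ^ n)
    ((summable_geometric_of_lt_one (abs_nonneg x) hx).mul_left C) fun n => ?_
  rw [Real.norm_eq_abs, abs_mul, abs_pow]
  exact mul_le_mul_of_nonneg_right (hA n) (by positivity)

lemma hasSum_powSum (hA : ∀ n, |A n| ≤ C) {x : ℝ} (hx : |x| < 1) :
    HasSum (fun n => A n * x ^ n) (powSum A x) :=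
  (summable_powSum hA hx).hasSum

lemma summable_deriv_bound {ρ : ℝ} (h0 : 0 ≤ ρ) (h1 : ρ < 1) :
    Summable fun n : ℕ => C * ((n : ℝ) * ρ ^ (n - 1)) := by
  refine Summable.mul_left C ?_
  rw [← summable_nat_add_iff 1]
  have h := (summable_pow_mul_geometric_of_norm_lt_one (R := ℝ) 1 (r := ρ)
    (by rwa [Real.norm_of_nonneg h0])).add
    (summable_geometric_of_lt_one h0 h1)
  refine h.congr fun n => ?_
  push_cast
  simp
  ring

lemma summable_deriv_powSum (hA : ∀ n, |A n| ≤ C) {x : ℝ} (hx : |x| < 1) :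
    Summable fun n : ℕ => A n * ((n : ℝ) * x ^ (n - 1)) := by
  refine Summable.of_norm_bounded (summable_deriv_bound (C := C) (abs_nonneg x) hx) fun n => ?_
  rw [Real.norm_eq_abs, abs_mul, abs_mul, abs_pow, Nat.abs_cast]
  exact mul_le_mul_of_nonneg_right (hA n) (by positivity)

lemma hasDerivAt_powSum (hA : ∀ n, |A n| ≤ C) {x : ℝ} (hx : |x| < 1) :
    HasDerivAt (powSum A) (∑' n : ℕ, A n * ((n : ℝ) * x ^ (n - 1))) x := by
  obtain ⟨ρ, hxρ, hρ⟩ := exists_between hx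
  have hρ0 : 0 < ρ := (abs_nonneg x).trans_lt hxρ
  refine hasDerivAt_tsum_of_isPreconnected (u := fun n : ℕ => C * ((n : ℝ) * ρ ^ (n - 1)))
    (t := Ioo (-ρ) ρ) (y₀ := 0) (summable_deriv_bound hρ0.le hρ) isOpen_Ioo
    isPreconnected_Ioo (fun n y _ => (hasDerivAt_pow n y).const_mul (A n)) (fun n y hy => ?_)
    (by simp [hρ0]) (summable_powSum hA (by simp)) (abs_lt.1 hxρ)
  rw [Real.norm_eq_abs, abs_mul, abs_mul, abs_pow, Nat.abs_cast]
  have hy' : |y| ≤ ρ := (abs_lt.2 hy).le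
  have := hA n
  have hC : 0 ≤ C := (abs_nonneg _).trans this
  gcongr

lemma mul_deriv_powSum (hA : ∀ n, |A n| ≤ C) {x : ℝ} (hx : |x| < 1) :
    HasSum (fun n : ℕ => (n * A n) * x ^ n) (x * ∑' n : ℕ, A n * ((n : ℝ) * x ^ (n - 1))) := by
  refine ((summable_deriv_powSum hA hx).hasSum.mul_left x).congr_fun ?_
  intro n
  cases n with
  | zero => simp
  | succ n => simp [pow_succ]; ring

lemma deriv_powSum_shift (hA : ∀ n, |A n| ≤ C) {x : ℝ} (hx : |x| < 1) :
    HasSum (fun n : ℕ => ((n + 1) * A (n + 1)) * x ^ n)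
      (∑' n : ℕ, A n * ((n : ℝ) * x ^ (n - 1))) := by
  have h := (summable_deriv_powSum hA hx).hasSum
  rw [← hasSum_nat_add_iff' 1] at h
  simp only [Finset.range_one, Finset.sum_singleton, CharP.cast_eq_zero, zero_mul, mul_zero,
    sub_zero] at h
  refine h.congr_fun fun n => ?_
  rw [Nat.add_sub_cancel]
  push_cast
  ring

/-- Chebyshev's inequality for two power series with nonnegative weights. -/
lemma finset_chebyshev {w g : ℕ → ℝ} (hw : ∀ n, 0 ≤ w n) (hg : Antitone g) {x y : ℝ}
    (hx : 0 ≤ x) (hxy : x ≤ y) (s : Finset ℕ) :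
    (∑ n ∈ s, w n * g n * y ^ n) * (∑ n ∈ s, w n * x ^ n) ≤
      (∑ n ∈ s, w n * g n * x ^ n) * (∑ n ∈ s, w n * y ^ n) := by
  have key : ∀ n m : ℕ, n ≤ m → (g n - g m) * (y ^ n * x ^ m - x ^ n * y ^ m) ≤ 0 := by
    intro n m h
    obtain ⟨d, rfl⟩ := Nat.exists_eq_add_of_le h
    have h1 : 0 ≤ g n - g (n + d) := sub_nonneg.2 (hg h)
    have h2 : x ^ d ≤ y ^ d := pow_le_pow_left₀ hx hxy d
    have hy : 0 ≤ y := hx.trans hxy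
    have h3 : y ^ n * x ^ (n + d) - x ^ n * y ^ (n + d) = - ((x * y) ^ n * (y ^ d - x ^ d)) := by
      rw [pow_add, pow_add, mul_pow]; ring
    rw [h3, mul_neg, neg_nonpos]
    exact mul_nonneg h1 (mul_nonneg (by positivity) (sub_nonneg.2 h2))
  have key' : ∀ n m : ℕ, (g n - g m) * (y ^ n * x ^ m - x ^ n * y ^ m) ≤ 0 := by
    intro n m
    rcases le_total n m with h | h
    · exact key n m h
    · have := key m n h
      linarith [mul_comm (x ^ m) (y ^ n)]
  have hS : ∑ n ∈ s, ∑ m ∈ s, w n * w m * ((g n - g m) * (y ^ n * x ^ m - x ^ n * y ^ m)) ≤ 0 :=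
    Finset.sum_nonpos fun n _ => Finset.sum_nonpos fun m _ =>
      mul_nonpos_of_nonneg_of_nonpos (mul_nonneg (hw n) (hw m)) (key' n m)
  -- Symmetrisation: the double sum counts the difference of the two products once as (n, m) and
  -- once as (m, n), hence the factor 2.
  have e : ∑ n ∈ s, ∑ m ∈ s, w n * w m * ((g n - g m) * (y ^ n * x ^ m - x ^ n * y ^ m)) =
      2 * ((∑ n ∈ s, w n * g n * y ^ n) * (∑ n ∈ s, w n * x ^ n) -
      (∑ n ∈ s, w n * g n * x ^ n) * (∑ n ∈ s, w n * y ^ n)) := by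
    have e1 := Finset.sum_mul_sum s s (fun n => w n * g n * y ^ n) (fun n => w n * x ^ n)
    have e2 := Finset.sum_mul_sum s s (fun n => w n * g n * x ^ n) (fun n => w n * y ^ n)
    have e3 := e1
    have e4 := e2
    rw [Finset.sum_comm] at e3 e4
    have : ∀ n m : ℕ, w n * w m * ((g n - g m) * (y ^ n * x ^ m - x ^ n * y ^ m)) =
      w n * g n * y ^ n * (w m * x ^ m) - w n * g n * x ^ n * (w m * y ^ m)
      + (w m * g m * y ^ m * (w n * x ^ n) - w m * g m * x ^ m * (w n * y ^ n)) := by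
      intro n m; ring
    simp only [this, Finset.sum_add_distrib, Finset.sum_sub_distrib]
    linarith
  linarith

/-- Passes the finite inequality to the limit. It serves as a monotonicity criterion: a quotient of
power series is decreasing on x ≥ 0 when the quotients g of their coefficients are. -/
lemma chebyshev_of_hasSum {w g : ℕ → ℝ} (hw : ∀ n, 0 ≤ w n) (hg : Antitone g) {x y : ℝ}
    (hx : 0 ≤ x) (hxy : x ≤ y) {Px Py Qx Qy : ℝ}
    (hPx : HasSum (fun n => w n * g n * x ^ n) Px) (hPy : HasSum (fun n => w n * g n * y ^ n) Py)
    (hQx : HasSum (fun n => w n * x ^ n) Qx) (hQy : HasSum (fun n => w n * y ^ n) Qy) :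
    Py * Qx ≤ Px * Qy :=
  le_of_tendsto_of_tendsto' (Tendsto.mul hPy hQx) (Tendsto.mul hPx hQy)
    fun s => finset_chebyshev hw hg hx hxy s

end PowSum

/-! ### The hypergeometric function F(a, c - a; c; x) and (1 - x)F' -/

/-- The Taylor coefficients of `F(a, c - a; c; ·)`. -/
noncomputable def coef (a c : ℝ) (n : ℕ) : ℝ :=
  ordinaryHypergeometricCoefficient a (c - a) c n

/-- `F(a, c - a; c; ·)` as a real power series. -/
noncomputable def hyp (a c : ℝ) : ℝ → ℝ := powSum (coef a c)

/-- The coefficients of `x ↦ (1 - x) F'(a, c - a; c; x)`. -/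
noncomputable def coefE (a c : ℝ) (n : ℕ) : ℝ := a * (c - a) * (coef a c n / (c + n))

/-- The function `x ↦ (1 - x) F'(a, c - a; c; x)` as a real power series. -/
noncomputable def hypE (a c : ℝ) : ℝ → ℝ := powSum (coefE a c)

lemma ordinaryHypergeometric_eq_hyp (a c x : ℝ) :
    ordinaryHypergeometric a (c - a) c x = hyp a c x := by
  rw [ordinaryHypergeometric_eq_tsum]
  rfl

section

variable {a c : ℝ}

lemma coef_zero : coef a c 0 = 1 := by
  simp [coef, ordinaryHypergeometricCoefficient]

lemma coef_succ (ha : 0 < a) (hac : a < c) (n : ℕ) :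
    (n + 1) * (c + n) * coef a c (n + 1) = (a + n) * (c - a + n) * coef a c n := by
  have hc : 0 < c := ha.trans hac
  have h1 : (0 : ℝ) < (ascPochhammer ℝ n).eval c := ascPochhammer_pos n c hc
  have h2 : (0 : ℝ) < n.factorial := by positivity
  have h3 : 0 < c + n := by positivity
  simp only [coef, ordinaryHypergeometricCoefficient, ascPochhammer_succ_eval, Nat.factorial_succ]
  push_cast
  field_simp

lemma coef_pos (ha : 0 < a) (hac : a < c) (n : ℕ) : 0 < coef a c n := by
  have hc : 0 < c := ha.trans hac
  have h1 := ascPochhammer_pos n c hc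
  have h2 := ascPochhammer_pos n a ha
  have h3 := ascPochhammer_pos n (c - a) (sub_pos.2 hac)
  unfold coef ordinaryHypergeometricCoefficient
  positivity

/-- AM-GM gives a(c - a) ≤ c²/4, and c ≤ 1 does the rest. The constant 1/4 is exactly what
`logAux_slope_nonneg` requires. -/
lemma param_le (hac : a < c) (ha : 0 < a) (hc : c ≤ 1) : a * (c - a) ≤ c / 4 := by
  nlinarith [sq_nonneg (c - 2 * a), mul_nonneg (ha.trans hac).le (sub_nonneg.2 hc)]

lemma coef_le_one (ha : 0 < a) (hac : a < c) (hc : c ≤ 1) (n : ℕ) : coef a c n ≤ 1 := by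
  have hc0 : 0 < c := ha.trans hac
  induction n with
  | zero => rw [coef_zero]
  | succ n ih =>
    have h := coef_succ ha hac n
    have hp := param_le hac ha hc
    have h0 := coef_pos ha hac n
    have h3 : (0 : ℝ) < (n + 1) * (c + n) := by positivity
    have h4 : (a + n) * (c - a + n) ≤ (n + 1) * (c + n) := by nlinarith [n.cast_nonneg (α := ℝ)]
    by_contra! h5
    nlinarith [mul_lt_mul_of_pos_left h5 h3, mul_le_mul_of_nonneg_left ih h3.le]

lemma abs_coef_le (ha : 0 < a) (hac : a < c) (hc : c ≤ 1) (n : ℕ) : |coef a c n| ≤ 1 := by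
  rw [abs_of_pos (coef_pos ha hac n)]
  exact coef_le_one ha hac hc n

lemma coefE_pos (ha : 0 < a) (hac : a < c) (n : ℕ) : 0 < coefE a c n := by
  have hc0 : 0 < c := ha.trans hac
  have := coef_pos ha hac n
  have := sub_pos.2 hac
  unfold coefE
  positivity

lemma coefE_le (ha : 0 < a) (hac : a < c) (n : ℕ) :
    coefE a c n ≤ a * (c - a) / c * coef a c n := by
  have hc0 : 0 < c := ha.trans hac
  have h1 := coef_pos ha hac n
  have h2 := sub_pos.2 hac
  rw [coefE, div_mul_eq_mul_div, mul_div_assoc]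
  gcongr
  simp

lemma abs_coefE_le (ha : 0 < a) (hac : a < c) (hc : c ≤ 1) (n : ℕ) : |coefE a c n| ≤ 1 := by
  have hc0 : 0 < c := ha.trans hac
  rw [abs_of_pos (coefE_pos ha hac n)]
  refine (coefE_le ha hac n).trans ?_
  have hp : a * (c - a) / c ≤ 1 / 4 := by
    rw [div_le_iff₀ hc0]; linarith [param_le hac ha hc]
  nlinarith [coef_le_one ha hac hc n, coef_pos ha hac n]

/-- The coefficients of (1 - x)F' are (n + 1)Aₙ₊₁ - nAₙ, and the recurrence turns them into `coefE`
because (a + n)(c - a + n) - n(c + n) = a(c - a). This uses that the first two parameters sum to the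
third. -/
lemma hasDerivAt_hyp (ha : 0 < a) (hac : a < c) (hc : c ≤ 1) {x : ℝ} (hx : |x| < 1) :
    HasDerivAt (hyp a c) (hypE a c x / (1 - x)) x := by
  have hc0 : 0 < c := ha.trans hac
  have hA := abs_coef_le ha hac hc
  have h := hasDerivAt_powSum hA hx
  have h1 := (deriv_powSum_shift hA hx).sub (mul_deriv_powSum hA hx)
  have h2 := hasSum_powSum (abs_coefE_le ha hac hc) hx
  have h3 : (∑' n : ℕ, coef a c n * ((n : ℝ) * x ^ (n - 1))) * (1 - x) = hypE a c x := by
    have := h1.unique (h2.congr_fun fun n => ?_)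
    · rw [hypE, ← this]; ring
    · rw [← sub_mul]
      congr 1
      have h3 : 0 < c + n := by positivity
      have := coef_succ ha hac n
      rw [coefE]
      field_simp
      linear_combination this
  have h4 : 1 - x ≠ 0 := by linarith [(abs_lt.1 hx).2]
  rw [← h3, mul_div_assoc, div_self h4, mul_one]
  exact h

/-- Coefficientwise, xE' + cE = a(c - a)F is just (c + n)Eₙ = a(c - a)Aₙ. -/
lemma hasDerivAt_hypE (ha : 0 < a) (hac : a < c) (hc : c ≤ 1) {x : ℝ} (hx : |x| < 1)
    (hx0 : x ≠ 0) :
    HasDerivAt (hypE a c) ((a * (c - a) * hyp a c x - c * hypE a c x) / x) x := by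
  have hc0 : 0 < c := ha.trans hac
  have hE := abs_coefE_le ha hac hc
  have h := hasDerivAt_powSum hE hx
  have h1 := mul_deriv_powSum hE hx
  have h2 := ((hasSum_powSum (abs_coef_le ha hac hc) hx).mul_left (a * (c - a))).sub
    ((hasSum_powSum hE hx).mul_left c)
  have h3 := h1.unique (h2.congr_fun fun n => ?_)
  · rw [hyp, hypE, ← h3, mul_comm, mul_div_assoc, div_self hx0, mul_one]
    exact h
  · have h3 : 0 < c + n := by positivity
    rw [coefE]
    field_simp
    ring

lemma abs_lt_one_of_mem {x : ℝ} (hx : x ∈ Ioo (0 : ℝ) 1) : |x| < 1 := by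
  rw [abs_of_pos hx.1]; exact hx.2

lemma one_le_hyp (ha : 0 < a) (hac : a < c) (hc : c ≤ 1) {x : ℝ} (hx : x ∈ Ioo (0 : ℝ) 1) :
    1 ≤ hyp a c x := by
  have h := (summable_powSum (abs_coef_le ha hac hc) (abs_lt_one_of_mem hx)).le_tsum 0
    fun n _ => mul_nonneg (coef_pos ha hac n).le (pow_nonneg hx.1.le n)
  simpa [coef_zero] using! h

lemma le_hypE (ha : 0 < a) (hac : a < c) (hc : c ≤ 1) {x : ℝ} (hx : x ∈ Ioo (0 : ℝ) 1) :
    a * (c - a) / c ≤ hypE a c x := by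
  have h := (summable_powSum (abs_coefE_le ha hac hc) (abs_lt_one_of_mem hx)).le_tsum 0
    fun n _ => mul_nonneg (coefE_pos ha hac n).le (pow_nonneg hx.1.le n)
  simpa [coefE, coef_zero, div_eq_mul_inv] using! h

lemma hypE_le (ha : 0 < a) (hac : a < c) (hc : c ≤ 1) {x : ℝ} (hx : x ∈ Ioo (0 : ℝ) 1) :
    hypE a c x ≤ a * (c - a) / c * hyp a c x := by
  refine hasSum_le (fun n => ?_) (hasSum_powSum (abs_coefE_le ha hac hc) (abs_lt_one_of_mem hx))
    ((hasSum_powSum (abs_coef_le ha hac hc) (abs_lt_one_of_mem hx)).mul_left _)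
  rw [← mul_assoc]
  exact mul_le_mul_of_nonneg_right (coefE_le ha hac n) (pow_nonneg hx.1.le n)

lemma one_sub_mul_hyp_le (ha : 0 < a) (hac : a < c) (hc : c ≤ 1) {x : ℝ}
    (hx : x ∈ Ioo (0 : ℝ) 1) : (1 - x) * hyp a c x ≤ 1 := by
  have h : hyp a c x ≤ (1 - x)⁻¹ :=
    hasSum_le (fun n => mul_le_of_le_one_left (pow_nonneg hx.1.le n) (coef_le_one ha hac hc n))
      (hasSum_powSum (abs_coef_le ha hac hc) (abs_lt_one_of_mem hx))
      (hasSum_geometric_of_lt_one hx.1.le hx.2)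
  have h1 : 0 < 1 - x := sub_pos.2 hx.2
  calc _ ≤ (1 - x) * (1 - x)⁻¹ := mul_le_mul_of_nonneg_left h h1.le
    _ = 1 := mul_inv_cancel₀ h1.ne'

/-- `(1 - x) F' / F` is decreasing. -/
lemma hypE_mul_hyp_le (ha : 0 < a) (hac : a < c) (hc : c ≤ 1) {x y : ℝ}
    (hx : x ∈ Ioo (0 : ℝ) 1) (hy : y ∈ Ioo (0 : ℝ) 1) (hxy : x ≤ y) :
    hypE a c y * hyp a c x ≤ hypE a c x * hyp a c y := by
  have hc0 : 0 < c := ha.trans hac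
  have h2 := sub_pos.2 hac
  have hE := abs_coefE_le ha hac hc
  have hA := abs_coef_le ha hac hc
  have e : ∀ z : ℝ, |z| < 1 →
      HasSum (fun n => coef a c n * (a * (c - a) / (c + n)) * z ^ n) (hypE a c z) := by
    intro z hz
    refine (hasSum_powSum hE hz).congr_fun fun n => ?_
    rw [coefE]; ring
  refine chebyshev_of_hasSum (fun n => (coef_pos ha hac n).le)
    (g := fun n => a * (c - a) / (c + n)) (fun n m h => ?_) hx.1.le hxy
    (e x (abs_lt_one_of_mem hx)) (e y (abs_lt_one_of_mem hy))
    (hasSum_powSum hA (abs_lt_one_of_mem hx)) (hasSum_powSum hA (abs_lt_one_of_mem hy))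
  dsimp only
  gcongr

/-- `x F' / F` is increasing. -/
lemma mul_deriv_hyp_mul_hyp_le (ha : 0 < a) (hac : a < c) (hc : c ≤ 1) {x y : ℝ}
    (hx : x ∈ Ioo (0 : ℝ) 1) (hy : y ∈ Ioo (0 : ℝ) 1) (hxy : x ≤ y) :
    x * (hypE a c x / (1 - x)) * hyp a c y ≤ y * (hypE a c y / (1 - y)) * hyp a c x := by
  have hA := abs_coef_le ha hac hc
  have e : ∀ z : ℝ, |z| < 1 →
      HasSum (fun n : ℕ => coef a c n * (-n : ℝ) * z ^ n) (-(z * (hypE a c z / (1 - z)))) := by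
    intro z hz
    have h1 := (hasDerivAt_hyp ha hac hc hz).unique (hasDerivAt_powSum hA hz)
    rw [h1]
    refine (mul_deriv_powSum hA hz).neg.congr_fun fun n => ?_
    ring
  -- The coefficient ratio of xF' to F is n, which increases; the sign is flipped to obtain the
  -- antitone weight.
  have := chebyshev_of_hasSum (fun n => (coef_pos ha hac n).le)
    (g := fun n : ℕ => (-n : ℝ)) (fun n m h => neg_le_neg (Nat.cast_le.2 h)) hx.1.le hxy
    (e x (abs_lt_one_of_mem hx)) (e y (abs_lt_one_of_mem hy))
    (hasSum_powSum hA (abs_lt_one_of_mem hx)) (hasSum_powSum hA (abs_lt_one_of_mem hy))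
  change -_ * hyp a c x ≤ -_ * hyp a c y at this
  linarith

/-- The sequence nAₙ is nondecreasing for n ≥ 1, so the coefficients dominate a multiple of the
harmonic series. -/
lemma coef_one_le (ha : 0 < a) (hac : a < c) (n : ℕ) :
    coef a c 1 ≤ (n + 1) * coef a c (n + 1) := by
  have hc0 : 0 < c := ha.trans hac
  induction n with
  | zero => simp
  | succ n ih =>
    refine ih.trans ?_
    have h := coef_succ ha hac (n + 1)
    have h0 := coef_pos ha hac (n + 1)
    push_cast at h ⊢
    have h3 : (0 : ℝ) < c + (n + 1) := by positivity
    refine le_of_mul_le_mul_left ?_ h3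
    have h4 : 0 < a * (c - a) * coef a c (n + 1) := mul_pos (mul_pos ha (sub_pos.2 hac)) h0
    linarith

/-- A bound for F on (0, 1) would, as x → 1, bound every partial sum of the coefficients,
contradicting their divergence. -/
lemma hyp_unbounded (ha : 0 < a) (hac : a < c) (hc : c ≤ 1) (M : ℝ) :
    ∃ x ∈ Ioo (0 : ℝ) 1, M < hyp a c x := by
  by_contra! hM
  have hns : ¬ Summable (coef a c) := by
    intro hs
    rw [← summable_nat_add_iff 1] at hs
    have h1 : Summable fun n : ℕ => coef a c 1 * (1 / ((n : ℝ) + 1)) := by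
      refine hs.of_nonneg_of_le (fun n => ?_) fun n => ?_
      · have := coef_pos ha hac 1
        positivity
      · rw [mul_one_div, div_le_iff₀ (by positivity), mul_comm]
        exact coef_one_le ha hac n
    rw [summable_mul_left_iff (coef_pos ha hac 1).ne'] at h1
    exact Real.not_summable_one_div_natCast
      ((summable_nat_add_iff 1).1 (by simpa using h1))
  refine hns (summable_of_sum_le (c := M) (fun n => (coef_pos ha hac n).le) fun s => ?_)
  have ht : Tendsto (fun x : ℝ => ∑ n ∈ s, coef a c n * x ^ n) (𝓝[<] 1)
      (𝓝 (∑ n ∈ s, coef a c n)) := by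
    have : Continuous fun x : ℝ => ∑ n ∈ s, coef a c n * x ^ n := by fun_prop
    simpa using (this.tendsto 1).mono_left nhdsWithin_le_nhds
  refine le_of_tendsto ht ?_
  filter_upwards [Ioo_mem_nhdsLT (zero_lt_one' ℝ)] with x hx
  exact ((summable_powSum (abs_coef_le ha hac hc) (abs_lt_one_of_mem hx)).sum_le_tsum s
    fun n _ => mul_nonneg (coef_pos ha hac n).le (pow_nonneg hx.1.le n)).trans (hM x hx)

end

/-! ### The modulus, its inverse, and the modular function in the variable r² -/

/-- The Legendre-type function `x (1 - x) (F'(x) F(1 - x) + F(x) F'(1 - x))`. -/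
noncomputable def leg (a c x : ℝ) : ℝ :=
  x * hypE a c x * hyp a c (1 - x) + (1 - x) * hyp a c x * hypE a c (1 - x)

/-- The logarithm of `F(1 - x) / F(x)`. -/
noncomputable def logMod (a c x : ℝ) : ℝ := Real.log (hyp a c (1 - x)) - Real.log (hyp a c x)

/-- Minus the derivative of `logMod`. -/
noncomputable def wt (a c x : ℝ) : ℝ :=
  hypE a c x / (1 - x) / hyp a c x + hypE a c (1 - x) / x / hyp a c (1 - x)

/-- The inverse of `logMod` on `(0, 1)`. -/
noncomputable def logModInv (a c : ℝ) : ℝ → ℝ := Function.invFunOn (logMod a c) (Ioo 0 1)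

/-- The modular function in the variable `x = r ^ 2`. -/
noncomputable def sqPhi (a c K x : ℝ) : ℝ := logModInv a c (logMod a c x - Real.log K)

section

variable {a c : ℝ}

lemma one_sub_mem {x : ℝ} (hx : x ∈ Ioo (0 : ℝ) 1) : 1 - x ∈ Ioo (0 : ℝ) 1 :=
  ⟨by linarith [hx.2], by linarith [hx.1]⟩

lemma hyp_pos (ha : 0 < a) (hac : a < c) (hc : c ≤ 1) {x : ℝ} (hx : x ∈ Ioo (0 : ℝ) 1) :
    0 < hyp a c x := zero_lt_one.trans_le (one_le_hyp ha hac hc hx)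

lemma hypE_pos (ha : 0 < a) (hac : a < c) (hc : c ≤ 1) {x : ℝ} (hx : x ∈ Ioo (0 : ℝ) 1) :
    0 < hypE a c x :=
  (div_pos (mul_pos ha (sub_pos.2 hac)) (ha.trans hac)).trans_le (le_hypE ha hac hc hx)

lemma leg_pos (ha : 0 < a) (hac : a < c) (hc : c ≤ 1) {x : ℝ} (hx : x ∈ Ioo (0 : ℝ) 1) :
    0 < leg a c x := by
  have h1 := hyp_pos ha hac hc hx
  have h2 := hyp_pos ha hac hc (one_sub_mem hx)
  have h3 := hypE_pos ha hac hc hx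
  have h4 := hypE_pos ha hac hc (one_sub_mem hx)
  have h5 := hx.1
  have h6 := (one_sub_mem hx).1
  unfold leg
  positivity

lemma leg_one_sub (x : ℝ) : leg a c (1 - x) = leg a c x := by
  unfold leg
  rw [sub_sub_cancel]
  ring

lemma logMod_one_sub (x : ℝ) : logMod a c (1 - x) = -logMod a c x := by
  unfold logMod
  rw [sub_sub_cancel]
  ring

lemma wt_eq (ha : 0 < a) (hac : a < c) (hc : c ≤ 1) {x : ℝ} (hx : x ∈ Ioo (0 : ℝ) 1) :
    wt a c x = leg a c x / (x * (1 - x) * (hyp a c x * hyp a c (1 - x))) := by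
  have h1 := (hyp_pos ha hac hc hx).ne'
  have h2 := (hyp_pos ha hac hc (one_sub_mem hx)).ne'
  have h5 := hx.1.ne'
  have h6 := (one_sub_mem hx).1.ne'
  unfold wt leg
  field_simp

lemma wt_pos (ha : 0 < a) (hac : a < c) (hc : c ≤ 1) {x : ℝ} (hx : x ∈ Ioo (0 : ℝ) 1) :
    0 < wt a c x := by
  rw [wt_eq ha hac hc hx]
  have h1 := hyp_pos ha hac hc hx
  have h2 := hyp_pos ha hac hc (one_sub_mem hx)
  have h3 := leg_pos ha hac hc hx
  have h5 := hx.1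
  have h6 := (one_sub_mem hx).1
  positivity

lemma hasDerivAt_hyp_one_sub (ha : 0 < a) (hac : a < c) (hc : c ≤ 1) {x : ℝ}
    (hx : x ∈ Ioo (0 : ℝ) 1) :
    HasDerivAt (fun x => hyp a c (1 - x)) (-(hypE a c (1 - x) / x)) x := by
  have h := (hasDerivAt_hyp ha hac hc (abs_lt_one_of_mem (one_sub_mem hx))).comp_const_sub 1 x
  rwa [sub_sub_cancel] at h

lemma hasDerivAt_hypE_one_sub (ha : 0 < a) (hac : a < c) (hc : c ≤ 1) {x : ℝ}
    (hx : x ∈ Ioo (0 : ℝ) 1) :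
    HasDerivAt (fun x => hypE a c (1 - x))
      (-((a * (c - a) * hyp a c (1 - x) - c * hypE a c (1 - x)) / (1 - x))) x :=
  (hasDerivAt_hypE ha hac hc (abs_lt_one_of_mem (one_sub_mem hx))
    (one_sub_mem hx).1.ne').comp_const_sub 1 x

/-- Follows from the first-order system for F and E. For c = 1 the function is constant, which is
the Legendre relation. -/
lemma hasDerivAt_leg (ha : 0 < a) (hac : a < c) (hc : c ≤ 1) {x : ℝ}
    (hx : x ∈ Ioo (0 : ℝ) 1) :
    HasDerivAt (leg a c)
      ((1 - c) * (hypE a c x * hyp a c (1 - x) - hyp a c x * hypE a c (1 - x))) x := by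
  have hx1 := abs_lt_one_of_mem hx
  have h := (((hasDerivAt_id x).mul (hasDerivAt_hypE ha hac hc hx1 hx.1.ne')).mul
    (hasDerivAt_hyp_one_sub ha hac hc hx)).add
    ((((hasDerivAt_id x).const_sub 1).mul (hasDerivAt_hyp ha hac hc hx1)).mul
    (hasDerivAt_hypE_one_sub ha hac hc hx))
  refine h.congr_deriv ?_
  have h5 := hx.1.ne'
  have h6 := (one_sub_mem hx).1.ne'
  simp only [id, Pi.mul_apply]
  field_simp
  ring

lemma hasDerivAt_logMod (ha : 0 < a) (hac : a < c) (hc : c ≤ 1) {x : ℝ}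
    (hx : x ∈ Ioo (0 : ℝ) 1) : HasDerivAt (logMod a c) (-wt a c x) x := by
  have h := ((hasDerivAt_hyp_one_sub ha hac hc hx).log
    (hyp_pos ha hac hc (one_sub_mem hx)).ne').sub
    ((hasDerivAt_hyp ha hac hc (abs_lt_one_of_mem hx)).log (hyp_pos ha hac hc hx).ne')
  refine h.congr_deriv ?_
  unfold wt
  ring

lemma strictAntiOn_logMod (ha : 0 < a) (hac : a < c) (hc : c ≤ 1) :
    StrictAntiOn (logMod a c) (Ioo 0 1) := by
  refine strictAntiOn_of_deriv_neg (convex_Ioo 0 1)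
    (fun x hx => (hasDerivAt_logMod ha hac hc hx).continuousAt.continuousWithinAt) fun x hx => ?_
  rw [interior_Ioo] at hx
  rw [(hasDerivAt_logMod ha hac hc hx).deriv]
  exact neg_lt_zero.2 (wt_pos ha hac hc hx)

lemma strictMonoOn_hyp (ha : 0 < a) (hac : a < c) (hc : c ≤ 1) :
    StrictMonoOn (hyp a c) (Ioo 0 1) := by
  have hd : ∀ x ∈ Ioo (0 : ℝ) 1, HasDerivAt (hyp a c) (hypE a c x / (1 - x)) x :=
    fun x hx => hasDerivAt_hyp ha hac hc (abs_lt_one_of_mem hx)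
  refine strictMonoOn_of_deriv_pos (convex_Ioo 0 1)
    (fun x hx => (hd x hx).continuousAt.continuousWithinAt) fun x hx => ?_
  rw [interior_Ioo] at hx
  rw [(hd x hx).deriv]
  exact div_pos (hypE_pos ha hac hc hx) (sub_pos.2 hx.2)

lemma exists_logMod_lt (ha : 0 < a) (hac : a < c) (hc : c ≤ 1) (t : ℝ) :
    ∃ x ∈ Ioo (0 : ℝ) 1, logMod a c x < t := by
  have hh : (1 / 2 : ℝ) ∈ Ioo (0 : ℝ) 1 := by norm_num
  have hp := hyp_pos ha hac hc hh
  obtain ⟨x, hx, hM⟩ := hyp_unbounded ha hac hc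
    (max (hyp a c (1 / 2)) (hyp a c (1 / 2) * Real.exp (-t)))
  obtain ⟨h1, h2⟩ := max_lt_iff.1 hM
  refine ⟨x, hx, ?_⟩
  have hx2 : 1 / 2 < x := (strictMonoOn_hyp ha hac hc).lt_iff_lt hh hx |>.1 h1
  have h3 : hyp a c (1 - x) ≤ hyp a c (1 / 2) :=
    (strictMonoOn_hyp ha hac hc).monotoneOn (one_sub_mem hx) hh (by linarith)
  have h4 := Real.log_le_log (hyp_pos ha hac hc (one_sub_mem hx)) h3
  have h5 := Real.log_lt_log (mul_pos hp (Real.exp_pos _)) h2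
  rw [Real.log_mul hp.ne' (Real.exp_pos _).ne', Real.log_exp] at h5
  unfold logMod
  linarith

lemma surjOn_logMod (ha : 0 < a) (hac : a < c) (hc : c ≤ 1) :
    SurjOn (logMod a c) (Ioo 0 1) univ := by
  intro t _
  obtain ⟨x, hx, h1⟩ := exists_logMod_lt ha hac hc t
  obtain ⟨y, hy, h2⟩ := exists_logMod_lt ha hac hc (-t)
  exact isPreconnected_Ioo.intermediate_value hx (one_sub_mem hy)
    (fun z hz => (hasDerivAt_logMod ha hac hc hz).continuousAt.continuousWithinAt)
    ⟨h1.le, by rw [logMod_one_sub]; linarith⟩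

lemma logModInv_mem (ha : 0 < a) (hac : a < c) (hc : c ≤ 1) (t : ℝ) :
    logModInv a c t ∈ Ioo (0 : ℝ) 1 :=
  Function.invFunOn_mem (surjOn_logMod ha hac hc (mem_univ t))

lemma logMod_logModInv (ha : 0 < a) (hac : a < c) (hc : c ≤ 1) (t : ℝ) :
    logMod a c (logModInv a c t) = t :=
  Function.invFunOn_eq (surjOn_logMod ha hac hc (mem_univ t))

lemma logModInv_logMod (ha : 0 < a) (hac : a < c) (hc : c ≤ 1) {x : ℝ}
    (hx : x ∈ Ioo (0 : ℝ) 1) : logModInv a c (logMod a c x) = x :=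
  (strictAntiOn_logMod ha hac hc).injOn (logModInv_mem ha hac hc _) hx
    (logMod_logModInv ha hac hc _)

lemma strictAnti_logModInv (ha : 0 < a) (hac : a < c) (hc : c ≤ 1) :
    StrictAnti (logModInv a c) := by
  intro s t hst
  rwa [← (strictAntiOn_logMod ha hac hc).lt_iff_gt (logModInv_mem ha hac hc s)
    (logModInv_mem ha hac hc t), logMod_logModInv ha hac hc, logMod_logModInv ha hac hc]

lemma continuous_logModInv (ha : 0 < a) (hac : a < c) (hc : c ≤ 1) :
    Continuous (logModInv a c) := by
  have hm : StrictMono fun t => logModInv a c (-t) :=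
    fun s t hst => strictAnti_logModInv ha hac hc (neg_lt_neg hst)
  have hcont : Continuous fun t => logModInv a c (-t) := by
    -- A monotone function whose image is a neighbourhood of its value is continuous there; the
    -- negated argument makes the inverse increasing.
    refine continuous_iff_continuousAt.2 fun t =>
      (hm.strictMonoOn univ).continuousAt_of_image_mem_nhds univ_mem ?_
    refine mem_of_superset (isOpen_Ioo.mem_nhds (logModInv_mem ha hac hc (-t))) fun x hx => ?_
    exact ⟨-logMod a c x, mem_univ _, by simp [logModInv_logMod ha hac hc hx]⟩
  simpa [Function.comp_def] using hcont.comp continuous_neg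

lemma hasDerivAt_logModInv (ha : 0 < a) (hac : a < c) (hc : c ≤ 1) (t : ℝ) :
    HasDerivAt (logModInv a c) (-wt a c (logModInv a c t))⁻¹ t :=
  HasDerivAt.of_local_left_inverse (continuous_logModInv ha hac hc).continuousAt
    (hasDerivAt_logMod ha hac hc (logModInv_mem ha hac hc t))
    (neg_lt_zero.2 (wt_pos ha hac hc (logModInv_mem ha hac hc t))).ne
    (Eventually.of_forall fun s => logMod_logModInv ha hac hc s)

variable {K : ℝ}

lemma sqPhi_mem (ha : 0 < a) (hac : a < c) (hc : c ≤ 1) (x : ℝ) :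
    sqPhi a c K x ∈ Ioo (0 : ℝ) 1 := logModInv_mem ha hac hc _

lemma logMod_sqPhi (ha : 0 < a) (hac : a < c) (hc : c ≤ 1) (x : ℝ) :
    logMod a c (sqPhi a c K x) = logMod a c x - Real.log K := logMod_logModInv ha hac hc _

lemma le_sqPhi (ha : 0 < a) (hac : a < c) (hc : c ≤ 1) (hK : 1 < K) {x : ℝ}
    (hx : x ∈ Ioo (0 : ℝ) 1) : x ≤ sqPhi a c K x := by
  rw [← (strictAntiOn_logMod ha hac hc).le_iff_ge (sqPhi_mem ha hac hc x) hx,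
    logMod_sqPhi ha hac hc]
  linarith [Real.log_pos hK]

lemma strictMonoOn_sqPhi (ha : 0 < a) (hac : a < c) (hc : c ≤ 1) :
    StrictMonoOn (sqPhi a c K) (Ioo 0 1) := fun _ hx _ hy hxy =>
  strictAnti_logModInv ha hac hc (sub_lt_sub_right (strictAntiOn_logMod ha hac hc hx hy hxy) _)

lemma hasDerivAt_sqPhi (ha : 0 < a) (hac : a < c) (hc : c ≤ 1) {x : ℝ}
    (hx : x ∈ Ioo (0 : ℝ) 1) :
    HasDerivAt (sqPhi a c K) (wt a c x / wt a c (sqPhi a c K x)) x := by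
  have h := (hasDerivAt_logModInv ha hac hc (logMod a c x - Real.log K)).comp x
    ((hasDerivAt_logMod ha hac hc hx).sub_const (Real.log K))
  refine h.congr_deriv ?_
  have := (wt_pos ha hac hc (sqPhi_mem (K := K) ha hac hc x)).ne'
  change (-wt a c (sqPhi a c K x))⁻¹ * _ = _
  field_simp

/-- The defining equation of `sqPhi` without logarithms, used to remove the values at 1 - x and 1 -
y from the slope. -/
lemma hyp_sqPhi_ratio (ha : 0 < a) (hac : a < c) (hc : c ≤ 1) (hK : 1 < K) {x : ℝ}
    (hx : x ∈ Ioo (0 : ℝ) 1) :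
    K * (hyp a c (1 - sqPhi a c K x) * hyp a c x) =
      hyp a c (1 - x) * hyp a c (sqPhi a c K x) := by
  have hy := sqPhi_mem (K := K) ha hac hc x
  have h := logMod_sqPhi (K := K) ha hac hc x
  have h1 := hyp_pos ha hac hc hx
  have h2 := hyp_pos ha hac hc (one_sub_mem hx)
  have h3 := hyp_pos ha hac hc hy
  have h4 := hyp_pos ha hac hc (one_sub_mem hy)
  have hK0 : 0 < K := zero_lt_one.trans hK
  unfold logMod at h
  refine Real.log_injOn_pos (mem_Ioi.2 (by positivity)) (mem_Ioi.2 (by positivity)) ?_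
  rw [Real.log_mul hK0.ne' (by positivity), Real.log_mul h4.ne' h1.ne', Real.log_mul h2.ne' h3.ne']
  linarith

lemma compl_sq {r : ℝ} (hr : r ∈ Ioo (0 : ℝ) 1) : compl r ^ 2 = 1 - r ^ 2 :=
  Real.sq_sqrt (by nlinarith [hr.1, hr.2])

lemma sq_mem {r : ℝ} (hr : r ∈ Ioo (0 : ℝ) 1) : r ^ 2 ∈ Ioo (0 : ℝ) 1 :=
  ⟨by have := hr.1; positivity, by nlinarith [hr.1, hr.2]⟩

lemma sqrt_mem {x : ℝ} (hx : x ∈ Ioo (0 : ℝ) 1) : Real.sqrt x ∈ Ioo (0 : ℝ) 1 :=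
  ⟨Real.sqrt_pos.2 hx.1, by rw [Real.sqrt_lt' one_pos]; simpa using hx.2⟩

lemma modulus_pos_log (ha : 0 < a) (hac : a < c) (hc : c ≤ 1) {r : ℝ}
    (hr : r ∈ Ioo (0 : ℝ) 1) :
    0 < modulus a (c - a) c r ∧ Real.log (modulus a (c - a) c r) =
      Real.log (ProbabilityTheory.beta a (c - a) / 2) + logMod a c (r ^ 2) := by
  have hB := ProbabilityTheory.beta_pos ha (sub_pos.2 hac)
  have h1 := hyp_pos ha hac hc (sq_mem hr)
  have h2 := hyp_pos ha hac hc (one_sub_mem (sq_mem hr))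
  rw [modulus, compl_sq hr, ordinaryHypergeometric_eq_hyp, ordinaryHypergeometric_eq_hyp]
  refine ⟨by positivity, ?_⟩
  rw [Real.log_mul (by positivity) (by positivity), Real.log_div h2.ne' h1.ne', logMod]

/-- After taking logarithms, the factor B/2 cancels from both sides. -/
lemma modulus_eq_div_iff (ha : 0 < a) (hac : a < c) (hc : c ≤ 1) (hK : 1 < K) {r s : ℝ}
    (hr : r ∈ Ioo (0 : ℝ) 1) (hs : s ∈ Ioo (0 : ℝ) 1) :
    modulus a (c - a) c s = modulus a (c - a) c r / K ↔ s ^ 2 = sqPhi a c K (r ^ 2) := by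
  obtain ⟨p1, e1⟩ := modulus_pos_log ha hac hc hr
  obtain ⟨p2, e2⟩ := modulus_pos_log ha hac hc hs
  have hK0 : 0 < K := zero_lt_one.trans hK
  rw [← Real.log_injOn_pos.eq_iff (mem_Ioi.2 p2) (mem_Ioi.2 (div_pos p1 hK0)),
    Real.log_div p1.ne' hK0.ne', e1, e2, add_sub_assoc, add_right_inj,
    ← logMod_sqPhi ha hac hc, (strictAntiOn_logMod ha hac hc).injOn.eq_iff (sq_mem hs)
      (sqPhi_mem ha hac hc _)]

/-- `φ_K(r)` is the square root of `sqPhi` at `r ^ 2`. -/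
lemma phi_eq_sqrt (ha : 0 < a) (hac : a < c) (hc : c ≤ 1) (hK : 1 < K) {r : ℝ}
    (hr : r ∈ Ioo (0 : ℝ) 1) : phi a c K r = Real.sqrt (sqPhi a c K (r ^ 2)) := by
  have hy := sqPhi_mem (K := K) ha hac hc (r ^ 2)
  have hex : ∃ s ∈ Ioo (0 : ℝ) 1, modulus a (c - a) c s = modulus a (c - a) c r / K :=
    ⟨_, sqrt_mem hy, (modulus_eq_div_iff ha hac hc hK hr (sqrt_mem hy)).2 (Real.sq_sqrt hy.1.le)⟩
  have hm : phi a c K r ∈ Ioo (0 : ℝ) 1 := Function.invFunOn_mem hex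
  have he : modulus a (c - a) c (phi a c K r) = modulus a (c - a) c r / K :=
    Function.invFunOn_eq hex
  rw [← (modulus_eq_div_iff ha hac hc hK hr hm).1 he, Real.sqrt_sq hm.1.le]

end

/-! ### Monotone factors of the logarithmic derivative -/

section

variable {a c : ℝ}

/-- Chains x F(1 - x) ≤ 1 with E(x) ≤ kF(x) and k ≤ E(1 - x), where k = a(c - a)/c. -/
lemma mul_hypE_mul_hyp_le (ha : 0 < a) (hac : a < c) (hc : c ≤ 1) {x : ℝ}
    (hx : x ∈ Ioo (0 : ℝ) 1) :
    x * hypE a c x * hyp a c (1 - x) ≤ hyp a c x * hypE a c (1 - x) := by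
  have hk : 0 < a * (c - a) / c := div_pos (mul_pos ha (sub_pos.2 hac)) (ha.trans hac)
  have h1 := one_sub_mul_hyp_le ha hac hc (one_sub_mem hx)
  rw [sub_sub_cancel] at h1
  have hF := hyp_pos ha hac hc hx
  calc x * hypE a c x * hyp a c (1 - x) = x * hyp a c (1 - x) * hypE a c x := by ring
    _ ≤ 1 * hypE a c x := mul_le_mul_of_nonneg_right h1 (hypE_pos ha hac hc hx).le
    _ ≤ a * (c - a) / c * hyp a c x := by rw [one_mul]; exact hypE_le ha hac hc hx
    _ = hyp a c x * (a * (c - a) / c) := mul_comm _ _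
    _ ≤ hyp a c x * hypE a c (1 - x) :=
      mul_le_mul_of_nonneg_left (le_hypE ha hac hc (one_sub_mem hx)) hF.le

lemma antitoneOn_leg_div_sqrt (ha : 0 < a) (hac : a < c) (hc : c ≤ 1) :
    AntitoneOn (fun x => leg a c x / Real.sqrt x) (Ioo 0 1) := by
  have hd : ∀ x ∈ Ioo (0 : ℝ) 1, HasDerivAt (fun x => leg a c x / Real.sqrt x)
      (((1 - c) * (hypE a c x * hyp a c (1 - x) - hyp a c x * hypE a c (1 - x)) * Real.sqrt x -
        leg a c x * (1 / (2 * Real.sqrt x))) / Real.sqrt x ^ 2) x := fun x hx =>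
    (hasDerivAt_leg ha hac hc hx).div (Real.hasDerivAt_sqrt hx.1.ne')
      (Real.sqrt_pos.2 hx.1).ne'
  refine antitoneOn_of_deriv_nonpos (convex_Ioo 0 1)
    (fun x hx => (hd x hx).continuousAt.continuousWithinAt) ?_ ?_
  · rw [interior_Ioo]
    exact fun x hx => (hd x hx).differentiableAt.differentiableWithinAt
  · rw [interior_Ioo]
    intro x hx
    rw [(hd x hx).deriv]
    refine div_nonpos_of_nonpos_of_nonneg ?_ (sq_nonneg _)
    have hs := Real.sqrt_pos.2 hx.1
    have hs2 := Real.sq_sqrt hx.1.le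
    -- This is 2xL' ≤ L with L = xp + (1 - x)q. If p ≤ q the left side is nonpositive; otherwise 1 -
    -- c ≤ 1 reduces it to xp ≤ (1 + x)q, implied by xp ≤ q.
    have key : 2 * x * ((1 - c) * (hypE a c x * hyp a c (1 - x) - hyp a c x * hypE a c (1 - x)))
        ≤ leg a c x := by
      have h1 := mul_hypE_mul_hyp_le ha hac hc hx
      have h2 := leg_pos ha hac hc hx
      have hc0 : 0 < c := ha.trans hac
      set p := hypE a c x * hyp a c (1 - x) with hp
      set q := hyp a c x * hypE a c (1 - x) with hq
      have hl : leg a c x = x * p + (1 - x) * q := by rw [leg, hp, hq]; ring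
      have h1' : x * p ≤ q := by rw [hp, ← mul_assoc]; exact h1
      rcases le_total p q with hpq | hpq
      · have : 0 ≤ 2 * x * ((1 - c) * (q - p)) :=
          mul_nonneg (by linarith [hx.1]) (mul_nonneg (by linarith) (by linarith))
        linarith
      · have h3 : (1 - c) * (p - q) ≤ p - q := mul_le_of_le_one_left (by linarith) (by linarith)
        have h4 := mul_le_mul_of_nonneg_left h3 (by linarith [hx.1] : 0 ≤ 2 * x)
        have h5 : 0 ≤ q := (mul_pos (hyp_pos ha hac hc hx)
          (hypE_pos ha hac hc (one_sub_mem hx))).le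
        nlinarith [mul_nonneg hx.1.le h5]
    have e : (1 - c) * (hypE a c x * hyp a c (1 - x) - hyp a c x * hypE a c (1 - x)) *
        Real.sqrt x - leg a c x * (1 / (2 * Real.sqrt x)) =
        (2 * x * ((1 - c) * (hypE a c x * hyp a c (1 - x) - hyp a c x * hypE a c (1 - x)))
        - leg a c x) / (2 * Real.sqrt x) := by
      rw [eq_div_iff (by positivity), sub_mul, mul_assoc (leg a c x),
        one_div_mul_cancel (by positivity)]
      linear_combination (2 * ((1 - c) *
        (hypE a c x * hyp a c (1 - x) - hyp a c x * hypE a c (1 - x)))) * hs2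
    rw [e]
    exact div_nonpos_of_nonpos_of_nonneg (sub_nonpos.2 key) (by positivity)

lemma antitoneOn_sqrt_div_leg (ha : 0 < a) (hac : a < c) (hc : c ≤ 1) :
    AntitoneOn (fun x => Real.sqrt (1 - x) / leg a c x) (Ioo 0 1) := by
  intro x hx y hy hxy
  have h := antitoneOn_leg_div_sqrt ha hac hc (one_sub_mem hy) (one_sub_mem hx)
    (sub_le_sub_left hxy 1)
  simp only [leg_one_sub] at h
  have h1 := leg_pos ha hac hc hx
  have h2 := Real.sqrt_pos.2 (one_sub_mem hx).1
  have := inv_anti₀ (div_pos h1 h2) h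
  simpa only [inv_div] using this

lemma hypE_div_hyp_anti (ha : 0 < a) (hac : a < c) (hc : c ≤ 1) {x y : ℝ}
    (hx : x ∈ Ioo (0 : ℝ) 1) (hy : y ∈ Ioo (0 : ℝ) 1) (hxy : x ≤ y) :
    hypE a c y / hyp a c y ≤ hypE a c x / hyp a c x := by
  rw [div_le_div_iff₀ (hyp_pos ha hac hc hy) (hyp_pos ha hac hc hx)]
  exact hypE_mul_hyp_le ha hac hc hx hy hxy

/-- The quantity is E/F at x plus zF'(z)/F(z) at z = 1 - x; the former decreases in x and the latter
increases in z. -/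
lemma one_sub_mul_wt_anti (ha : 0 < a) (hac : a < c) (hc : c ≤ 1) {x y : ℝ}
    (hx : x ∈ Ioo (0 : ℝ) 1) (hy : y ∈ Ioo (0 : ℝ) 1) (hxy : x ≤ y) :
    (1 - y) * wt a c y ≤ (1 - x) * wt a c x := by
  have e : ∀ z ∈ Ioo (0 : ℝ) 1, (1 - z) * wt a c z = hypE a c z / hyp a c z +
      (1 - z) * (hypE a c (1 - z) / (1 - (1 - z))) / hyp a c (1 - z) := by
    intro z hz
    have := (one_sub_mem hz).1.ne'
    rw [wt, sub_sub_cancel]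
    field_simp
  rw [e x hx, e y hy]
  refine add_le_add (hypE_div_hyp_anti ha hac hc hx hy hxy) ?_
  rw [div_le_div_iff₀ (hyp_pos ha hac hc (one_sub_mem hy)) (hyp_pos ha hac hc (one_sub_mem hx))]
  exact mul_deriv_hyp_mul_hyp_le ha hac hc (one_sub_mem hy) (one_sub_mem hx)
    (sub_le_sub_left hxy 1)

/-- The logarithm of `√(1 - x) F(x)²`. -/
noncomputable def logAux (a c x : ℝ) : ℝ := Real.log (1 - x) / 2 + 2 * Real.log (hyp a c x)

lemma exp_logAux (ha : 0 < a) (hac : a < c) (hc : c ≤ 1) {x : ℝ} (hx : x ∈ Ioo (0 : ℝ) 1) :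
    Real.exp (logAux a c x) = Real.sqrt (1 - x) * hyp a c x ^ 2 := by
  have h1 := hyp_pos ha hac hc hx
  have h2 := (one_sub_mem hx).1
  have h3 := Real.sqrt_pos.2 h2
  rw [logAux, ← Real.log_sqrt h2.le, Real.exp_add, Real.exp_log h3, two_mul, Real.exp_add,
    Real.exp_log h1, sq]

lemma hasDerivAt_logAux (ha : 0 < a) (hac : a < c) (hc : c ≤ 1) {x : ℝ}
    (hx : x ∈ Ioo (0 : ℝ) 1) :
    HasDerivAt (logAux a c) (-((1 / 2 - 2 * (hypE a c x / hyp a c x)) / (1 - x))) x := by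
  have h1 := (hyp_pos ha hac hc hx).ne'
  have h2 := (one_sub_mem hx).1.ne'
  have h := ((((hasDerivAt_id x).const_sub 1).log h2).div_const 2).add
    (((hasDerivAt_hyp ha hac hc (abs_lt_one_of_mem hx)).log h1).const_mul 2)
  refine h.congr_deriv ?_
  simp only [id]
  field_simp
  ring

lemma logAux_slope_nonneg (ha : 0 < a) (hac : a < c) (hc : c ≤ 1) {x : ℝ}
    (hx : x ∈ Ioo (0 : ℝ) 1) : 0 ≤ 1 / 2 - 2 * (hypE a c x / hyp a c x) := by
  have hc0 : 0 < c := ha.trans hac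
  have h1 : hypE a c x / hyp a c x ≤ a * (c - a) / c := by
    rw [div_le_iff₀ (hyp_pos ha hac hc hx)]
    exact hypE_le ha hac hc hx
  have h2 : a * (c - a) / c ≤ 1 / 4 := by
    rw [div_le_iff₀ hc0]; linarith [param_le hac ha hc]
  linarith

variable {K : ℝ}

/-- Put N = 1/2 - 2E/F, so that `logAux` has derivative -N/(1 - x). As dy/dx is wt(x)/wt(y), the
claim becomes that N/((1 - x)wt) is no larger at x than at y ≥ x: N is nonnegative and increasing,
while (1 - x)wt is positive and decreasing. -/
lemma antitoneOn_logAux_sub (ha : 0 < a) (hac : a < c) (hc : c ≤ 1) (hK : 1 < K) :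
    AntitoneOn (fun x => logAux a c (sqPhi a c K x) - logAux a c x) (Ioo 0 1) := by
  have hd := fun x (hx : x ∈ Ioo (0 : ℝ) 1) =>
    ((hasDerivAt_logAux ha hac hc (sqPhi_mem (K := K) ha hac hc x)).comp x
      (hasDerivAt_sqPhi ha hac hc hx)).sub (hasDerivAt_logAux ha hac hc hx)
  refine antitoneOn_of_deriv_nonpos (convex_Ioo 0 1)
    (fun x hx => (hd x hx).continuousAt.continuousWithinAt) ?_ ?_
  · rw [interior_Ioo]
    exact fun x hx => (hd x hx).differentiableAt.differentiableWithinAt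
  · rw [interior_Ioo]
    intro x hx
    refine (hd x hx).deriv.trans_le ?_
    have hy := sqPhi_mem (K := K) ha hac hc x
    have hxy := le_sqPhi ha hac hc hK hx
    set y := sqPhi a c K x
    have hwx := wt_pos ha hac hc hx
    have hwy := wt_pos ha hac hc hy
    have hx1 := (one_sub_mem hx).1
    have hy1 := (one_sub_mem hy).1
    have h : (1 / 2 - 2 * (hypE a c x / hyp a c x)) / ((1 - x) * wt a c x) ≤
        (1 / 2 - 2 * (hypE a c y / hyp a c y)) / ((1 - y) * wt a c y) :=
      div_le_div₀ (logAux_slope_nonneg ha hac hc hy)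
        (by linarith [hypE_div_hyp_anti ha hac hc hx hy hxy])
        (by positivity) (one_sub_mul_wt_anti ha hac hc hx hy hxy)
    have h' := mul_le_mul_of_nonneg_right h hwx.le
    have e1 : (1 / 2 - 2 * (hypE a c x / hyp a c x)) / ((1 - x) * wt a c x) * wt a c x =
        (1 / 2 - 2 * (hypE a c x / hyp a c x)) / (1 - x) := by
      rw [← div_div, div_mul_cancel₀ _ hwx.ne']
    have e2 : (1 / 2 - 2 * (hypE a c y / hyp a c y)) / ((1 - y) * wt a c y) * wt a c x =
        (1 / 2 - 2 * (hypE a c y / hyp a c y)) / (1 - y) * (wt a c x / wt a c y) := by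
      rw [← div_div, div_mul_eq_mul_div, mul_div_assoc]
    rw [e1, e2] at h'
    linarith

/-- The logarithmic derivative of `sqPhi`. -/
noncomputable def slope (a c K x : ℝ) : ℝ :=
  wt a c x / wt a c (sqPhi a c K x) / sqPhi a c K x

lemma hasDerivAt_log_sqPhi (ha : 0 < a) (hac : a < c) (hc : c ≤ 1) {x : ℝ}
    (hx : x ∈ Ioo (0 : ℝ) 1) :
    HasDerivAt (fun x => Real.log (sqPhi a c K x)) (slope a c K x) x :=
  (hasDerivAt_sqPhi ha hac hc hx).log (sqPhi_mem ha hac hc x).1.ne'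

lemma slope_pos (ha : 0 < a) (hac : a < c) (hc : c ≤ 1) {x : ℝ}
    (hx : x ∈ Ioo (0 : ℝ) 1) : 0 < slope a c K x :=
  div_pos (div_pos (wt_pos ha hac hc hx) (wt_pos ha hac hc (sqPhi_mem ha hac hc x)))
    (sqPhi_mem ha hac hc x).1

lemma sqrt_mul_slope_eq (ha : 0 < a) (hac : a < c) (hc : c ≤ 1) (hK : 1 < K) {x : ℝ}
    (hx : x ∈ Ioo (0 : ℝ) 1) :
    Real.sqrt x * Real.sqrt (1 - Real.sqrt x) * slope a c K x =
      leg a c x / Real.sqrt x * (Real.sqrt (1 - sqPhi a c K x) / leg a c (sqPhi a c K x)) *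
      Real.exp (logAux a c (sqPhi a c K x) - logAux a c x) *
      (Real.sqrt (1 + Real.sqrt x))⁻¹ * K⁻¹ := by
  have hr := hyp_sqPhi_ratio ha hac hc hK hx
  have hy := sqPhi_mem (K := K) ha hac hc x
  unfold slope
  rw [wt_eq ha hac hc hx, wt_eq ha hac hc hy, Real.exp_sub, exp_logAux ha hac hc hx,
    exp_logAux ha hac hc hy]
  set y := sqPhi a c K x
  have hlx := leg_pos ha hac hc hx
  have hly := leg_pos ha hac hc hy
  have h1 := hyp_pos ha hac hc hx
  have h2 := hyp_pos ha hac hc (one_sub_mem hx)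
  have h3 := hyp_pos ha hac hc hy
  have h4 := hyp_pos ha hac hc (one_sub_mem hy)
  have hs := sqrt_mem hx
  have hy0 := hy.1
  have hK0 : 0 < K := zero_lt_one.trans hK
  have hx1 : 1 - x = (1 - Real.sqrt x) * (1 + Real.sqrt x) := by
    linear_combination Real.sq_sqrt hx.1.le
  have hsx : Real.sqrt (1 - x) = Real.sqrt (1 - Real.sqrt x) * Real.sqrt (1 + Real.sqrt x) := by
    rw [hx1, Real.sqrt_mul (one_sub_mem hs).1.le]
  have hp := Real.sqrt_pos.2 (one_sub_mem hs).1
  have hq : 0 < Real.sqrt (1 + Real.sqrt x) := Real.sqrt_pos.2 (by linarith [hs.1])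
  have hry := Real.sqrt_pos.2 (one_sub_mem hy).1
  have ep := Real.sq_sqrt (one_sub_mem hs).1.le
  have eq' := Real.sq_sqrt (by linarith [hs.1] : 0 ≤ 1 + Real.sqrt x)
  have ey := Real.sq_sqrt (one_sub_mem hy).1.le
  have es := Real.sq_sqrt hx.1.le
  have hx1' : 1 - x = Real.sqrt (1 - Real.sqrt x) ^ 2 * Real.sqrt (1 + Real.sqrt x) ^ 2 := by
    rw [ep, eq', hx1]
  rw [hsx]
  -- With the roots as free variables and x, 1 - x, 1 - y written as squares, the identity is
  -- rational and only needs the relation `hr`.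
  generalize hyp a c (1 - x) = G at *
  generalize hyp a c (1 - y) = Gy at *
  generalize Real.sqrt (1 - Real.sqrt x) = p at *
  generalize Real.sqrt (1 + Real.sqrt x) = q at *
  generalize Real.sqrt (1 - y) = ry at *
  rw [hx1', ← ey]
  have hs0 := hs.1
  generalize Real.sqrt x = s at *
  rw [← es] at h1 hr hlx ⊢
  field_simp
  linear_combination hr

lemma strictAntiOn_sqrt_mul_slope (ha : 0 < a) (hac : a < c) (hc : c ≤ 1) (hK : 1 < K) :
    StrictAntiOn (fun x => Real.sqrt x * Real.sqrt (1 - Real.sqrt x) * slope a c K x)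
      (Ioo 0 1) := by
  intro x hx y hy hxy
  dsimp only
  rw [sqrt_mul_slope_eq ha hac hc hK hx, sqrt_mul_slope_eq ha hac hc hK hy]
  have hX := sqPhi_mem (K := K) ha hac hc x
  have hY := sqPhi_mem (K := K) ha hac hc y
  have hXY := strictMonoOn_sqPhi (K := K) ha hac hc hx hy hxy
  have f1 := antitoneOn_leg_div_sqrt ha hac hc hx hy hxy.le
  have f2 := antitoneOn_sqrt_div_leg ha hac hc hX hY hXY.le
  have f3 := Real.exp_le_exp.2 (antitoneOn_logAux_sub ha hac hc hK hx hy hxy.le)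
  have f4 : (Real.sqrt (1 + Real.sqrt y))⁻¹ < (Real.sqrt (1 + Real.sqrt x))⁻¹ := by
    refine inv_strictAnti₀ (Real.sqrt_pos.2 (by linarith [(sqrt_mem hx).1])) ?_
    refine Real.sqrt_lt_sqrt (by linarith [(sqrt_mem hx).1]) ?_
    linarith [Real.sqrt_lt_sqrt hx.1.le hxy]
  have p1 : ∀ z ∈ Ioo (0 : ℝ) 1, 0 < leg a c z / Real.sqrt z := fun z hz =>
    div_pos (leg_pos ha hac hc hz) (Real.sqrt_pos.2 hz.1)
  have p2 : ∀ z ∈ Ioo (0 : ℝ) 1, 0 < Real.sqrt (1 - z) / leg a c z := fun z hz =>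
    div_pos (Real.sqrt_pos.2 (one_sub_mem hz).1) (leg_pos ha hac hc hz)
  have hK0 : 0 < K⁻¹ := inv_pos.2 (zero_lt_one.trans hK)
  have f12 := mul_le_mul f1 f2 (p2 _ hY).le (p1 x hx).le
  have f123 := mul_le_mul f12 f3 (Real.exp_pos _).le (mul_pos (p1 x hx) (p2 _ hX)).le
  refine mul_lt_mul_of_pos_right ?_ hK0
  exact mul_lt_mul' f123 f4 (inv_nonneg.2 (Real.sqrt_nonneg _))
    (mul_pos (mul_pos (p1 x hx) (p2 _ hX)) (Real.exp_pos _))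

end

/-! ### Strict concavity and midpoint inequalities for φ_K -/

section

variable {a c K : ℝ}

lemma phi_mem (ha : 0 < a) (hac : a < c) (hc : c ≤ 1) (hK : 1 < K) {r : ℝ}
    (hr : r ∈ Ioo (0 : ℝ) 1) : phi a c K r ∈ Ioo (0 : ℝ) 1 := by
  rw [phi_eq_sqrt ha hac hc hK hr]
  exact sqrt_mem (sqPhi_mem ha hac hc _)

lemma strictMonoOn_phi (ha : 0 < a) (hac : a < c) (hc : c ≤ 1) (hK : 1 < K) :
    StrictMonoOn (phi a c K) (Ioo 0 1) := by
  intro r hr s hs hrs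
  rw [phi_eq_sqrt ha hac hc hK hr, phi_eq_sqrt ha hac hc hK hs]
  exact Real.sqrt_lt_sqrt (sqPhi_mem ha hac hc _).1.le
    (strictMonoOn_sqPhi ha hac hc (sq_mem hr) (sq_mem hs) (pow_lt_pow_left₀ hrs hr.1.le two_ne_zero))

lemma hasDerivAt_log_phi (ha : 0 < a) (hac : a < c) (hc : c ≤ 1) (hK : 1 < K) {r : ℝ}
    (hr : r ∈ Ioo (0 : ℝ) 1) :
    HasDerivAt (fun r => Real.log (phi a c K r)) (r * slope a c K (r ^ 2)) r := by
  have h := ((HasDerivAt.comp (h := fun r : ℝ => r ^ 2) r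
    (hasDerivAt_log_sqPhi (K := K) ha hac hc (sq_mem hr)) (hasDerivAt_pow 2 r)).div_const 2)
  refine (h.congr_deriv ?_).congr_of_eventuallyEq ?_
  · simp
    ring
  · filter_upwards [isOpen_Ioo.mem_nhds hr] with s hs
    rw [phi_eq_sqrt ha hac hc hK hs, Real.log_sqrt (sqPhi_mem ha hac hc _).1.le]
    rfl

/-- Strict concavity from a strictly decreasing derivative on an open convex set. -/
lemma strictConcaveOn_of_hasDerivAt {D : Set ℝ} (hD : Convex ℝ D) (hO : IsOpen D) {f f' : ℝ → ℝ}
    (hf : ∀ x ∈ D, HasDerivAt f (f' x) x) (hf' : StrictAntiOn f' D) : StrictConcaveOn ℝ D f := by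
  refine StrictAntiOn.strictConcaveOn_of_deriv hD
    (fun x hx => (hf x hx).continuousAt.continuousWithinAt) ?_
  rw [hO.interior_eq]
  intro x hx y hy hxy
  rw [(hf x hx).deriv, (hf y hy).deriv]
  exact hf' hx hy hxy

lemma mul_le_midpoint_sq {s : Set ℝ} {h : ℝ → ℝ} (hpos : ∀ x ∈ s, 0 < h x)
    (hc : StrictConcaveOn ℝ s fun x => Real.log (h x)) {u t : ℝ} (hu : u ∈ s) (ht : t ∈ s) :
    h u * h t ≤ h ((u + t) / 2) ^ 2 ∧ (h u * h t = h ((u + t) / 2) ^ 2 ↔ u = t) := by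
  rcases eq_or_ne u t with rfl | hut
  · have : (u + u) / 2 = u := by ring
    rw [this]
    exact ⟨(sq _).ge, by simp [sq]⟩
  · have h1 := hc.2 hu ht hut one_half_pos one_half_pos (add_halves 1)
    have hm := hc.1 hu ht one_half_pos.le one_half_pos.le (add_halves 1)
    have e : (1 / 2 : ℝ) • u + (1 / 2 : ℝ) • t = (u + t) / 2 := by
      simp only [smul_eq_mul]; ring
    rw [e] at h1 hm
    simp only [smul_eq_mul] at h1
    have hlt : h u * h t < h ((u + t) / 2) ^ 2 := by
      rw [← Real.log_lt_log_iff (mul_pos (hpos u hu) (hpos t ht)) (pow_pos (hpos _ hm) 2),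
        Real.log_mul (hpos u hu).ne' (hpos t ht).ne', Real.log_pow]
      push_cast
      linarith
    exact ⟨hlt.le, iff_of_false hlt.ne hut⟩

/-- Equality with the larger bound forces equality with the smaller one, so the equality case
survives replacing a midpoint by a product via AM-GM. -/
lemma weaken_sq_bound {p m m' : ℝ} {Q Q' : Prop} (h : p ≤ m ^ 2 ∧ (p = m ^ 2 ↔ Q)) (hm : 0 ≤ m)
    (hmm : m ≤ m') (hQ : Q → Q') (he : Q' → p = m' ^ 2) : p ≤ m' ^ 2 ∧ (p = m' ^ 2 ↔ Q') := by
  have h1 : m ^ 2 ≤ m' ^ 2 := pow_le_pow_left₀ hm hmm 2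
  exact ⟨h.1.trans h1, fun hp => hQ (h.2.1 (h.1.antisymm (hp ▸ h1))), he⟩

lemma compl_mem {r : ℝ} (hr : r ∈ Ioo (0 : ℝ) 1) : compl r ∈ Ioo (0 : ℝ) 1 :=
  sqrt_mem (one_sub_mem (sq_mem hr))

lemma compl_compl {r : ℝ} (hr : r ∈ Ioo (0 : ℝ) 1) : compl (compl r) = r := by
  rw [compl, compl_sq hr, sub_sub_cancel, Real.sqrt_sq hr.1.le]

lemma compl_injOn : InjOn compl (Ioo 0 1) := fun _ hu _ ht h => by
  rw [← compl_compl hu, h, compl_compl ht]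

lemma strictAntiOn_compl : StrictAntiOn compl (Ioo 0 1) := fun _ hu _ ht h =>
  Real.sqrt_lt_sqrt (one_sub_mem (sq_mem ht)).1.le
    (sub_lt_sub_left (pow_lt_pow_left₀ h hu.1.le two_ne_zero) 1)

lemma hasDerivAt_compl {r : ℝ} (hr : r ∈ Ioo (0 : ℝ) 1) :
    HasDerivAt compl (-r / compl r) r := by
  have h1 := one_sub_mem (sq_mem hr)
  have h := ((hasDerivAt_pow 2 r).const_sub 1).sqrt h1.1.ne'
  refine h.congr_deriv ?_
  have : Real.sqrt (1 - r ^ 2) ≠ 0 := (Real.sqrt_pos.2 h1.1).ne'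
  simp only [compl]
  field_simp
  simp

lemma sqrt_mul_eq_compl_mul {u : ℝ} (t : ℝ) (hu : u ∈ Ioo (0 : ℝ) 1) :
    Real.sqrt ((1 - u ^ 2) * (1 - t ^ 2)) = compl u * compl t :=
  Real.sqrt_mul (one_sub_mem (sq_mem hu)).1.le _

lemma midpoint_mem {u t : ℝ} (hu : u ∈ Ioo (0 : ℝ) 1) (ht : t ∈ Ioo (0 : ℝ) 1) :
    (u + t) / 2 ∈ Ioo (0 : ℝ) 1 :=
  ⟨by linarith [hu.1, ht.1], by linarith [hu.2, ht.2]⟩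

lemma mul_mem {u t : ℝ} (hu : u ∈ Ioo (0 : ℝ) 1) (ht : t ∈ Ioo (0 : ℝ) 1) :
    u * t ∈ Ioo (0 : ℝ) 1 :=
  ⟨mul_pos hu.1 ht.1, mul_lt_one_of_nonneg_of_lt_one_left hu.1.le hu.2 ht.2.le⟩

lemma mul_le_midpoint (u t : ℝ) : u * t ≤ ((u + t) / 2) ^ 2 := by
  nlinarith [sq_nonneg (u - t)]

lemma strictConcaveOn_log_phi_compl (ha : 0 < a) (hac : a < c) (hc : c ≤ 1) (hK : 1 < K) :
    StrictConcaveOn ℝ (Ioo 0 1) fun r => Real.log (phi a c K (compl r)) := by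
  have hd := fun r (hr : r ∈ Ioo (0 : ℝ) 1) =>
    (hasDerivAt_log_phi ha hac hc hK (compl_mem hr)).comp r (hasDerivAt_compl hr)
  refine strictConcaveOn_of_hasDerivAt (f' := fun r => -(r * slope a c K (compl r ^ 2)))
    (convex_Ioo 0 1) isOpen_Ioo (fun r hr => (hd r hr).congr_deriv ?_) fun r hr t ht h => ?_
  · have := (compl_mem hr).1.ne'
    field_simp
  -- With v = `compl z`, z = √(1 - v)√(1 + v), so the derivative is the master function at v² times
  -- √(1 + v)/v, also decreasing in v.
  · have e : ∀ z ∈ Ioo (0 : ℝ) 1, z * slope a c K (compl z ^ 2) =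
        Real.sqrt (compl z ^ 2) * Real.sqrt (1 - Real.sqrt (compl z ^ 2)) *
          slope a c K (compl z ^ 2) * (Real.sqrt (1 + compl z) / compl z) := by
      intro z hz
      have h1 := compl_mem hz
      have h2 : Real.sqrt (1 - compl z) * Real.sqrt (1 + compl z) = z := by
        rw [← Real.sqrt_mul (one_sub_mem h1).1.le,
          show (1 - compl z) * (1 + compl z) = 1 - compl z ^ 2 by ring, compl_sq hz,
          sub_sub_cancel, Real.sqrt_sq hz.1.le]
      rw [Real.sqrt_sq h1.1.le]
      have := h1.1.ne'
      field_simp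
      linear_combination (-slope a c K (compl z ^ 2)) * h2
    have hr' := compl_mem hr
    have ht' := compl_mem ht
    have hlt := strictAntiOn_compl hr ht h
    refine neg_lt_neg ?_
    rw [e r hr, e t ht]
    refine mul_lt_mul'' (strictAntiOn_sqrt_mul_slope ha hac hc hK (sq_mem ht') (sq_mem hr')
      (pow_lt_pow_left₀ hlt ht'.1.le two_ne_zero)) ?_ ?_ ?_
    · have e2 : ∀ z ∈ Ioo (0 : ℝ) 1, Real.sqrt (1 + z) / z = Real.sqrt ((1 + z) / z ^ 2) := by
        intro z hz
        rw [Real.sqrt_div (by linarith [hz.1]), Real.sqrt_sq hz.1.le]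
      rw [e2 _ hr', e2 _ ht']
      refine Real.sqrt_lt_sqrt (div_nonneg (by linarith [hr'.1]) (sq_nonneg _)) ?_
      rw [div_lt_div_iff₀ (sq_mem hr').1 (sq_mem ht').1]
      nlinarith [hr'.1, ht'.1, mul_pos hr'.1 ht'.1]
    · exact mul_nonneg (by positivity) (slope_pos ha hac hc (sq_mem hr')).le
    · exact div_nonneg (Real.sqrt_nonneg _) hr'.1.le

lemma strictConcaveOn_log_phi_compl_sq (ha : 0 < a) (hac : a < c) (hc : c ≤ 1) (hK : 1 < K) :
    StrictConcaveOn ℝ (Ioo 0 1) fun r => Real.log (phi a c K (compl r ^ 2)) := by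
  have hd := fun r (hr : r ∈ Ioo (0 : ℝ) 1) =>
    (hasDerivAt_log_phi ha hac hc hK (sq_mem (compl_mem hr))).comp r ((hasDerivAt_compl hr).pow 2)
  refine strictConcaveOn_of_hasDerivAt
    (f' := fun r => -(2 * (compl r ^ 2 * r * slope a c K ((compl r ^ 2) ^ 2))))
    (convex_Ioo 0 1) isOpen_Ioo (fun r hr => (hd r hr).congr_deriv ?_) fun r hr t ht h => ?_
  · have := (compl_mem hr).1.ne'
    field_simp
    simp
    ring
  · have e : ∀ z ∈ Ioo (0 : ℝ) 1, compl z ^ 2 * z * slope a c K ((compl z ^ 2) ^ 2) =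
        Real.sqrt ((compl z ^ 2) ^ 2) * Real.sqrt (1 - Real.sqrt ((compl z ^ 2) ^ 2)) *
          slope a c K ((compl z ^ 2) ^ 2) := by
      intro z hz
      rw [Real.sqrt_sq (sq_nonneg _), compl_sq hz, sub_sub_cancel, Real.sqrt_sq hz.1.le]
    have hr' := sq_mem (compl_mem hr)
    have ht' := sq_mem (compl_mem ht)
    have hlt := pow_lt_pow_left₀ (strictAntiOn_compl hr ht h) (compl_mem ht).1.le two_ne_zero
    refine neg_lt_neg (mul_lt_mul_of_pos_left ?_ two_pos)
    rw [e r hr, e t ht]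
    exact strictAntiOn_sqrt_mul_slope ha hac hc hK (sq_mem ht') (sq_mem hr')
      (pow_lt_pow_left₀ hlt ht'.1.le two_ne_zero)

lemma one_sub_exp_mem {r : ℝ} (hr : r ∈ Ioi (0 : ℝ)) : 1 - Real.exp (-r) ∈ Ioo (0 : ℝ) 1 :=
  one_sub_mem ⟨Real.exp_pos _, Real.exp_lt_one_iff.2 (neg_lt_zero.2 hr)⟩

lemma strictConcaveOn_log_phi_one_sub_exp (ha : 0 < a) (hac : a < c) (hc : c ≤ 1) (hK : 1 < K) :
    StrictConcaveOn ℝ (Ioi 0) fun r => Real.log (phi a c K (1 - Real.exp (-r))) := by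
  have hd := fun r (hr : r ∈ Ioi (0 : ℝ)) =>
    (hasDerivAt_log_phi ha hac hc hK (one_sub_exp_mem hr)).comp r
      ((hasDerivAt_neg r).exp.const_sub 1)
  refine strictConcaveOn_of_hasDerivAt
    (f' := fun r => (1 - Real.exp (-r)) * Real.exp (-r) * slope a c K ((1 - Real.exp (-r)) ^ 2))
    (convex_Ioi 0) isOpen_Ioi (fun r hr => (hd r hr).congr_deriv (by ring)) fun r hr t ht h => ?_
  -- With v = 1 - exp(-z), the factor v(1 - v) is v√(1 - v) from the master function times √(1 - v)
  -- = √(exp(-z)), itself decreasing in z.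
  have e : ∀ z : ℝ, z ∈ Ioi 0 → (1 - Real.exp (-z)) * Real.exp (-z) *
      slope a c K ((1 - Real.exp (-z)) ^ 2) =
      Real.sqrt ((1 - Real.exp (-z)) ^ 2) * Real.sqrt (1 - Real.sqrt ((1 - Real.exp (-z)) ^ 2)) *
        slope a c K ((1 - Real.exp (-z)) ^ 2) * Real.sqrt (Real.exp (-z)) := by
    intro z hz
    rw [Real.sqrt_sq (one_sub_exp_mem hz).1.le, sub_sub_cancel]
    linear_combination (-(1 - Real.exp (-z)) * slope a c K ((1 - Real.exp (-z)) ^ 2)) *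
      Real.sq_sqrt (Real.exp_pos (-z)).le
  have hr' := one_sub_exp_mem hr
  have ht' := one_sub_exp_mem ht
  have hexp : Real.exp (-t) < Real.exp (-r) := Real.exp_lt_exp.2 (neg_lt_neg h)
  dsimp only
  rw [e r hr, e t ht]
  refine mul_lt_mul'' (strictAntiOn_sqrt_mul_slope ha hac hc hK (sq_mem hr') (sq_mem ht')
    (pow_lt_pow_left₀ (sub_lt_sub_left hexp 1) hr'.1.le two_ne_zero)) ?_ ?_ (Real.sqrt_nonneg _)
  · exact Real.sqrt_lt_sqrt (Real.exp_pos _).le hexp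
  · exact mul_nonneg (by positivity) (slope_pos ha hac hc (sq_mem ht')).le

/-- Midpoint concavity at -log u and -log t, whose arithmetic mean is minus the logarithm of the
geometric mean √(ut). -/
lemma phi_one_sub_mul_le (ha : 0 < a) (hac : a < c) (hc : c ≤ 1) (hK : 1 < K) {u t : ℝ}
    (hu : u ∈ Ioo (0 : ℝ) 1) (ht : t ∈ Ioo (0 : ℝ) 1) :
    phi a c K (1 - u) * phi a c K (1 - t) ≤ phi a c K (1 - Real.sqrt (u * t)) ^ 2 ∧
      (phi a c K (1 - u) * phi a c K (1 - t) = phi a c K (1 - Real.sqrt (u * t)) ^ 2 ↔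
        u = t) := by
  have h := mul_le_midpoint_sq (h := fun r => phi a c K (1 - Real.exp (-r)))
    (fun r hr => (phi_mem ha hac hc hK (one_sub_exp_mem hr)).1)
    (strictConcaveOn_log_phi_one_sub_exp ha hac hc hK)
    (u := -Real.log u) (t := -Real.log t)
    (mem_Ioi.2 (neg_pos.2 (Real.log_neg hu.1 hu.2)))
    (mem_Ioi.2 (neg_pos.2 (Real.log_neg ht.1 ht.2)))
  have e : Real.exp (-((-Real.log u + -Real.log t) / 2)) = Real.sqrt (u * t) := by
    have hut := mul_pos hu.1 ht.1
    rw [← Real.exp_log (Real.sqrt_pos.2 hut), Real.log_sqrt hut.le,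
      Real.log_mul hu.1.ne' ht.1.ne']
    congr 1
    ring
  simp only [neg_neg, Real.exp_log hu.1, Real.exp_log ht.1, e, neg_inj] at h
  rwa [Real.log_injOn_pos.eq_iff hu.1 ht.1] at h

end

end GenModular

/-! ### The main theorem -/

open GenModular Set

theorem mainTheorem8 (a c K : ℝ) (ha : 0 < a) (hac : a < c) (hc : c ≤ 1) (hK : 1 < K) :
    -- (1)
    (StrictAntiOn (fun r : ℝ => Real.log (GenModular.phi a c K (GenModular.compl r)))
        (Set.Ioo 0 1) ∧
      ConcaveOn ℝ (Set.Ioo 0 1)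
        (fun r : ℝ => Real.log (GenModular.phi a c K (GenModular.compl r))) ∧
      ∀ u ∈ Set.Ioo (0 : ℝ) 1, ∀ t ∈ Set.Ioo (0 : ℝ) 1,
        (GenModular.phi a c K (GenModular.compl u) * GenModular.phi a c K (GenModular.compl t)
            ≤ GenModular.phi a c K (Real.sqrt (1 - ((u + t) / 2) ^ 2)) ^ 2 ∧
          (GenModular.phi a c K (GenModular.compl u) * GenModular.phi a c K (GenModular.compl t)
            = GenModular.phi a c K (Real.sqrt (1 - ((u + t) / 2) ^ 2)) ^ 2 ↔ u = t)) ∧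
        (GenModular.phi a c K u * GenModular.phi a c K t
            ≤ GenModular.phi a c K
                (Real.sqrt (1 - Real.sqrt ((1 - u ^ 2) * (1 - t ^ 2)))) ^ 2 ∧
          (GenModular.phi a c K u * GenModular.phi a c K t
            = GenModular.phi a c K
                (Real.sqrt (1 - Real.sqrt ((1 - u ^ 2) * (1 - t ^ 2)))) ^ 2 ↔ u = t))) ∧
    -- (2)
    (StrictAntiOn (fun r : ℝ => Real.log (GenModular.phi a c K (GenModular.compl r ^ 2)))
        (Set.Ioo 0 1) ∧
      ConcaveOn ℝ (Set.Ioo 0 1)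
        (fun r : ℝ => Real.log (GenModular.phi a c K (GenModular.compl r ^ 2))) ∧
      ∀ u ∈ Set.Ioo (0 : ℝ) 1, ∀ t ∈ Set.Ioo (0 : ℝ) 1,
        (GenModular.phi a c K (GenModular.compl u ^ 2) *
              GenModular.phi a c K (GenModular.compl t ^ 2)
            ≤ GenModular.phi a c K (1 - ((u + t) / 2) ^ 2) ^ 2 ∧
          (GenModular.phi a c K (GenModular.compl u ^ 2) *
              GenModular.phi a c K (GenModular.compl t ^ 2)
            = GenModular.phi a c K (1 - ((u + t) / 2) ^ 2) ^ 2 ↔ u = t)) ∧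
        (GenModular.phi a c K (u ^ 2) * GenModular.phi a c K (t ^ 2)
            ≤ GenModular.phi a c K (1 - Real.sqrt ((1 - u ^ 2) * (1 - t ^ 2))) ^ 2 ∧
          (GenModular.phi a c K (u ^ 2) * GenModular.phi a c K (t ^ 2)
            = GenModular.phi a c K (1 - Real.sqrt ((1 - u ^ 2) * (1 - t ^ 2))) ^ 2 ↔ u = t))) ∧
    -- (3)
    (StrictMonoOn (fun r : ℝ => Real.log (GenModular.phi a c K (1 - Real.exp (-r))))
        (Set.Ioi 0) ∧
      ConcaveOn ℝ (Set.Ioi 0)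
        (fun r : ℝ => Real.log (GenModular.phi a c K (1 - Real.exp (-r)))) ∧
      ∀ u ∈ Set.Ioo (0 : ℝ) 1, ∀ t ∈ Set.Ioo (0 : ℝ) 1,
        (GenModular.phi a c K (1 - u) * GenModular.phi a c K (1 - t)
            ≤ GenModular.phi a c K (1 - Real.sqrt (u * t)) ^ 2 ∧
          (GenModular.phi a c K (1 - u) * GenModular.phi a c K (1 - t)
            = GenModular.phi a c K (1 - Real.sqrt (u * t)) ^ 2 ↔ u = t)) ∧
        (GenModular.phi a c K u * GenModular.phi a c K t
            ≤ GenModular.phi a c K (1 - Real.sqrt ((1 - u) * (1 - t))) ^ 2 ∧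
          (GenModular.phi a c K u * GenModular.phi a c K t
            = GenModular.phi a c K (1 - Real.sqrt ((1 - u) * (1 - t))) ^ 2 ↔ u = t))) := by

  have hmono := strictMonoOn_phi ha hac hc hK
  have hmem : ∀ r ∈ Ioo (0 : ℝ) 1, phi a c K r ∈ Ioo (0 : ℝ) 1 :=
    fun r hr => phi_mem ha hac hc hK hr
  have hlog : ∀ r ∈ Ioo (0 : ℝ) 1, ∀ s ∈ Ioo (0 : ℝ) 1, r < s →
      Real.log (phi a c K r) < Real.log (phi a c K s) :=
    fun r hr s hs h => Real.log_lt_log (hmem r hr).1 (hmono hr hs h)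
  have c1 := strictConcaveOn_log_phi_compl ha hac hc hK
  have c2 := strictConcaveOn_log_phi_compl_sq ha hac hc hK
  have c3 := strictConcaveOn_log_phi_one_sub_exp ha hac hc hK
  have m1 : ∀ u ∈ Ioo (0 : ℝ) 1, ∀ t ∈ Ioo (0 : ℝ) 1, _ := fun u hu t ht =>
    mul_le_midpoint_sq (fun r hr => (hmem _ (compl_mem hr)).1) c1 hu ht
  have m2 : ∀ u ∈ Ioo (0 : ℝ) 1, ∀ t ∈ Ioo (0 : ℝ) 1, _ := fun u hu t ht =>
    mul_le_midpoint_sq (fun r hr => (hmem _ (sq_mem (compl_mem hr))).1) c2 hu ht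
  refine ⟨⟨fun r hr t ht h => hlog _ (compl_mem ht) _ (compl_mem hr) (strictAntiOn_compl hr ht h),
    c1.concaveOn, fun u hu t ht => ⟨m1 u hu t ht, ?_⟩⟩,
    ⟨fun r hr t ht h => hlog _ (sq_mem (compl_mem ht)) _ (sq_mem (compl_mem hr))
      (pow_lt_pow_left₀ (strictAntiOn_compl hr ht h) (compl_mem ht).1.le two_ne_zero),
    c2.concaveOn, fun u hu t ht => ⟨?_, ?_⟩⟩,
    ⟨fun r hr t ht h => hlog _ (one_sub_exp_mem hr) _ (one_sub_exp_mem ht)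
      (sub_lt_sub_left (Real.exp_lt_exp.2 (neg_lt_neg h)) 1),
    c3.concaveOn, fun u hu t ht => ⟨phi_one_sub_mul_le ha hac hc hK hu ht, ?_⟩⟩⟩
  · have hu' := compl_mem hu
    have ht' := compl_mem ht
    have hv := midpoint_mem hu' ht'
    have h := m1 _ hu' _ ht'
    rw [compl_compl hu, compl_compl ht] at h
    rw [sqrt_mul_eq_compl_mul t hu]
    -- The first inequality is applied at u', t'; then u't' ≤ ((u' + t')/2)² and monotonicity of φ_K
    -- enlarge the right side.
    refine weaken_sq_bound h (hmem _ (compl_mem hv)).1.le (hmono.monotoneOn (compl_mem hv)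
      (sqrt_mem (one_sub_mem (mul_mem hu' ht')))
      (Real.sqrt_le_sqrt (sub_le_sub_left (mul_le_midpoint _ _) 1)))
      (fun h => compl_injOn hu ht h) ?_
    rintro rfl
    rw [← sq (GenModular.compl u), ← GenModular.compl, compl_compl hu, sq]
  · have h := m2 u hu t ht
    rwa [compl_sq (midpoint_mem hu ht)] at h
  · have hu' := compl_mem hu
    have ht' := compl_mem ht
    have hv := midpoint_mem hu' ht'
    have h := m2 _ hu' _ ht'
    rw [compl_compl hu, compl_compl ht] at h
    rw [sqrt_mul_eq_compl_mul t hu]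
    refine weaken_sq_bound h (hmem _ (sq_mem (compl_mem hv))).1.le
      (hmono.monotoneOn (sq_mem (compl_mem hv)) (one_sub_mem (mul_mem hu' ht')) ?_)
      (fun h => compl_injOn hu ht h) ?_
    · rw [compl_sq hv]
      exact sub_le_sub_left (mul_le_midpoint _ _) 1
    · rintro rfl
      rw [← sq (GenModular.compl u), compl_sq hu, sub_sub_cancel, ← sq]
  · have h := phi_one_sub_mul_le ha hac hc hK (one_sub_mem hu) (one_sub_mem ht)
    rwa [sub_sub_cancel, sub_sub_cancel, sub_right_inj] at h
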